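/- For a finite simple graph $\Gamma$ with vertex set $V$ and edge set $E$, let $$G(\Gamma)=\langle s\in V \mid s^2=1\ (s\in V),\ (ss')^2=1\ (\{s,s'\}\in E)\rangle$$ be the right-angled Coxeter group based on $\Gamma$. A word $w\in V^*$ is geodesic if its length $|w|$ equals $|\overline w|_V$, the least length of a word over $V$ representing the same element $\overline w$ of $G(\Gamma)$. The geodesic growth series of $G(\Gamma)$ is the formal power series $\sum_{r\ge 0} f(r)\,t^r$, where $f(r)$ is the number of geodesic words of length $r$. For rooted trees $\tau$ and $\sigma$, let $\tau\cdot\sigma$ be the tree obtained from their disjoint union by identifying the two roots. Let $T_1$ and $T_2$ be the trees of McKay on the vertex set $\{0,1,\dots,15\}$, both rooted at $0$, with edges - $T_1$: $01,\ 02,\ 13,\ 14,\ 25,\ 36,\ 47,\ 58,\ 59,\ \{8,10\},\ \{9,11\},\ \{10,12\},\ \{11,13\},\ \{13,14\},\ \{13,15\}$, where $ab$ stands for $\{a,b\}$; - $T_2$: $01,\ 02,\ 13,\ 24,\ 25,\ 36,\ 37,\ 48,\ 59,\ \{8,10\},\ \{9,11\},\ \{11,12\},\ \{11,13\},\ \{12,14\},\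 \{13,15\}$. Then for every finite rooted tree $\tau$, the groups $G(\Gamma_1)$ and $G(\Gamma_2)$ based on $\Gamma_1=\tau\cdot T_1$ and $\Gamma_2=\tau\cdot T_2$ have the same geodesic growth series. -/

import Mathlib

/-- The Coxeter matrix of a simple graph `Γ`: the entry is `1` on the diagonal, `2` at adjacent
vertices and `0` (meaning `∞`, no relation) at distinct non-adjacent vertices. -/
noncomputable def racgMatrix {V : Type*} (Γ : SimpleGraph V) : CoxeterMatrix V where
  M := open Classical in
    Matrix.of fun a b => if a = b then 1 else if Γ.Adj a b then 2 else 0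
  isSymm := by
    ext a b
    have h₁ : (b = a) = (a = b) := propext eq_comm
    have h₂ : Γ.Adj b a = Γ.Adj a b := propext (Γ.adj_comm b a)
    simp only [Matrix.transpose_apply, Matrix.of_apply]
    congr 1
    congr 1
  diagonal a := by simp
  off_diagonal a b h := by
    simp only [Matrix.of_apply, if_neg h]
    split_ifs <;> simp

/-- The right-angled Coxeter group `⟨s ∈ V ∣ s² = 1, (s s')² = 1 for {s, s'} ∈ E(Γ)⟩`. -/
abbrev RACG {V : Type*} (Γ : SimpleGraph V) : Type _ := (racgMatrix Γ).Group

/-- The group `RACG Γ` with its standard generators, the vertices of `Γ`. -/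
noncomputable abbrev racgSystem {V : Type*} (Γ : SimpleGraph V) :
    CoxeterSystem (racgMatrix Γ) (RACG Γ) := (racgMatrix Γ).toCoxeterSystem

/-- The set of geodesic words: words `w` over the vertices of `Γ` whose length equals the word
length, with respect to the vertex generators, of the element of `RACG Γ` that `w` represents. -/
def racgGeodesics {V : Type*} (Γ : SimpleGraph V) : Set (List V) :=
  {w | w.length = (racgSystem Γ).length ((racgSystem Γ).wordProd w)}

/-- The strict growth function of a set of words over an alphabet: the number of its words of
length `r`. -/
noncomputable def strictGrowth {S : Type*} (L : Set (List S)) (r : ℕ) : ℕ :=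
  {w ∈ L | w.length = r}.ncard

/-- The geodesic growth series of the right-angled Coxeter group based on `Γ`. -/
noncomputable def geodesicGrowthSeries {V : Type*} (Γ : SimpleGraph V) : PowerSeries ℕ :=
  PowerSeries.mk (strictGrowth (racgGeodesics Γ))

/-- The coalescence of `τ` rooted at `r` and `σ` rooted at `s`: the two graphs are merged at their
roots. The vertices are those of `τ`, together with those of `σ` other than `s`; the vertex `r`
plays the part of both roots. -/
def coalescence {V W : Type*} (τ : SimpleGraph V) (r : V) (σ : SimpleGraph W) (s : W) :
    SimpleGraph (V ⊕ {w : W // w ≠ s}) where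
  Adj
    | .inl a, .inl b => τ.Adj a b
    | .inl a, .inr w => a = r ∧ σ.Adj s w
    | .inr w, .inl a => a = r ∧ σ.Adj s w
    | .inr w, .inr w' => σ.Adj w w'
  symm := ⟨by
    rintro (a | w) (b | w') h
    · exact SimpleGraph.Adj.symm (G := τ) h
    · exact h
    · exact h
    · exact SimpleGraph.Adj.symm (G := σ) h⟩
  loopless := ⟨by
    rintro (a | w) h
    · exact τ.irrefl h
    · exact σ.irrefl h⟩

/-- McKay's first tree, on the vertices `0, …, 15` and rooted at `0`. -/
def mckayT₁ : SimpleGraph (Fin 16) :=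
  SimpleGraph.fromEdgeSet
    {s(0, 1), s(0, 2), s(1, 3), s(1, 4), s(2, 5), s(3, 6), s(4, 7), s(5, 8), s(5, 9),
      s(8, 10), s(9, 11), s(10, 12), s(11, 13), s(13, 14), s(13, 15)}

/-- McKay's second tree, on the vertices `0, …, 15` and rooted at `0`. -/
def mckayT₂ : SimpleGraph (Fin 16) :=
  SimpleGraph.fromEdgeSet
    {s(0, 1), s(0, 2), s(1, 3), s(2, 4), s(2, 5), s(3, 6), s(3, 7), s(4, 8), s(5, 9),
      s(8, 10), s(9, 11), s(11, 12), s(11, 13), s(12, 14), s(13, 15)}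

/-! Geodesic words are recognised by an automaton whose states are cliques of right descents
(`mem_racgGeodesics_iff`). In a triangle-free graph the states after the start are single vertices
and edges, so counting words by their first letter gives a finite linear system over `ℤ⟦X⟧`.
Eliminating the edge states leaves one unknown per vertex and the system `M x = k 1`, where `M = (1
+ t)(1 + 2t) - t(1 + t) deg + t² adj` is the identity modulo `t`. The growth series is then
determined by the number of vertices and `1ᵀ M⁻¹ 1` (`laplaceEq_admissibleSeries_sub_linkDefect`,
`admissibleSeries_empty_eq_sum`).

In a coalescence, the vertices of the second graph off the root can be eliminated. With `N` the
block of `M` off the root and `b` the indicator of the root's neighbours, the rest of the system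
sees only the root degree and the series `bᵀ N⁻¹ b`, `bᵀ N⁻¹ 1`, `1ᵀ N⁻¹ 1`
(`sum_eq_of_rootElimination`). McKay's two trees share these data, which explicit polynomial
certificates verify. -/

/-! ### Geodesic words are the words accepted by the descent-set automaton -/

section Geodesics

variable {V : Type*} (Γ : SimpleGraph V)

/-- The transition of the descent-set automaton: the set of letters that can be moved to the end of
a geodesic word, after the letter `a` has been appended. -/
def descentStep (σ : Set V) (a : V) : Set V := insert a {b ∈ σ | Γ.Adj a b}

/-- The words accepted by the descent-set automaton started at the descent set `σ`. -/
def Admissible : Set V → List V → Prop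
  | _, [] => True
  | σ, a :: l => a ∉ σ ∧ Admissible (descentStep Γ σ a) l

theorem admissible_append_singleton (σ : Set V) (l : List V) (a : V) :
    Admissible Γ σ (l ++ [a]) ↔ Admissible Γ σ l ∧ a ∉ l.foldl (descentStep Γ) σ := by
  induction l generalizing σ with
  | nil => simp [Admissible]
  | cons b l ih => simp [Admissible, ih, and_assoc]

open Classical in
theorem racgMatrix_apply (a b : V) :
    racgMatrix Γ a b = if a = b then 1 else if Γ.Adj a b then 2 else 0 := rfl

theorem racg_simple_comm {a b : V} (h : Γ.Adj a b) :
    (racgSystem Γ).simple a * (racgSystem Γ).simple b =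
      (racgSystem Γ).simple b * (racgSystem Γ).simple a := by
  have h₂ : racgMatrix Γ a b = 2 := by rw [racgMatrix_apply, if_neg h.ne, if_pos h]
  have h₃ := (racgSystem Γ).simple_mul_simple_pow a b
  rw [h₂, pow_two] at h₃
  have h₄ := eq_inv_of_mul_eq_one_left h₃
  rwa [mul_inv_rev, CoxeterSystem.inv_simple, CoxeterSystem.inv_simple] at h₄

/-- The letters in the state reached by a reduced word are right descents. -/
theorem isRightDescent_of_mem_foldl {w : List V} (hw : (racgSystem Γ).IsReduced w) {a : V}
    (ha : a ∈ w.foldl (descentStep Γ) ∅) :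
    (racgSystem Γ).IsRightDescent ((racgSystem Γ).wordProd w) a := by
  induction w using List.reverseRecOn generalizing a with
  | nil => simp at ha
  | append_singleton w s ih =>
    have hw' : (racgSystem Γ).IsReduced w := by simpa using hw.take w.length
    have hlen := hw.eq
    have hlen' := hw'.eq
    rw [CoxeterSystem.wordProd_append, CoxeterSystem.wordProd_singleton] at hlen ⊢
    rw [List.length_append, List.length_singleton] at hlen
    rw [List.foldl_append, List.foldl_cons, List.foldl_nil] at ha
    rcases ha with rfl | ⟨ha, hadj⟩
    · rw [CoxeterSystem.IsRightDescent, CoxeterSystem.simple_mul_simple_cancel_right]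
      omega
    · have h := ih hw' ha
      rw [CoxeterSystem.IsRightDescent] at h ⊢
      -- Commuting `s` past `a` gives `w s a = (w a) s`, whose length is at most `ℓ(w a) + 1 < |w| +
      -- 1 = ℓ(w s)`.
      rw [mul_assoc, racg_simple_comm Γ hadj, ← mul_assoc]
      have := (racgSystem Γ).length_mul_simple
        ((racgSystem Γ).wordProd w * (racgSystem Γ).simple a) s
      omega

theorem admissible_of_isReduced {w : List V} (hw : (racgSystem Γ).IsReduced w) :
    Admissible Γ ∅ w := by
  induction w using List.reverseRecOn with
  | nil => trivial
  | append_singleton w s ih =>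
    have hw' : (racgSystem Γ).IsReduced w := by simpa using hw.take w.length
    refine (admissible_append_singleton Γ ∅ w s).2 ⟨ih hw', fun hs => ?_⟩
    have h := isRightDescent_of_mem_foldl Γ hw' hs
    have hlen := hw.eq
    have hlen' := hw'.eq
    rw [CoxeterSystem.wordProd_append, CoxeterSystem.wordProd_singleton, List.length_append,
      List.length_singleton] at hlen
    rw [CoxeterSystem.IsRightDescent] at h
    omega

open Classical in
/-- The action of the generator `s` on integer weights on the simple roots: the dual of the
geometric representation. -/
noncomputable def reflectWeight (s : V) (φ : V → ℤ) : V → ℤ := fun a =>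
  if a = s then -φ s else if Γ.Adj s a then φ a else φ a + 2 * φ s

theorem reflectWeight_self (s : V) (φ : V → ℤ) : reflectWeight Γ s φ s = -φ s := by
  simp [reflectWeight]

theorem reflectWeight_of_adj {s a : V} (h : Γ.Adj s a) (φ : V → ℤ) :
    reflectWeight Γ s φ a = φ a := by
  simp [reflectWeight, h, h.ne']

theorem reflectWeight_of_not_adj {s a : V} (hne : a ≠ s) (h : ¬Γ.Adj s a) (φ : V → ℤ) :
    reflectWeight Γ s φ a = φ a + 2 * φ s := by
  simp [reflectWeight, h, hne]

theorem reflectWeight_reflectWeight (s : V) (φ : V → ℤ) :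
    reflectWeight Γ s (reflectWeight Γ s φ) = φ := by
  funext a
  by_cases h : a = s
  · subst h; simp [reflectWeight_self]
  · by_cases h' : Γ.Adj s a
    · simp [reflectWeight_of_adj Γ h']
    · simp [reflectWeight_of_not_adj Γ h h', reflectWeight_self]

theorem reflectWeight_comm {s t : V} (h : Γ.Adj s t) (φ : V → ℤ) :
    reflectWeight Γ s (reflectWeight Γ t φ) = reflectWeight Γ t (reflectWeight Γ s φ) := by
  funext a
  have hts := h.symm
  have hne := h.ne
  simp only [reflectWeight]
  split_ifs <;> simp_all
  ring

/-- The generator `s` as an endomorphism of the set of weights, acting on the right. -/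
noncomputable def reflectWeightEnd (s : V) : (Function.End (V → ℤ))ᵐᵒᵖ :=
  MulOpposite.op (reflectWeight Γ s)

theorem isLiftable_reflectWeightEnd : (racgMatrix Γ).IsLiftable (reflectWeightEnd Γ) := by
  intro s t
  have hsq : ∀ s, reflectWeightEnd Γ s * reflectWeightEnd Γ s = 1 := fun s =>
    MulOpposite.unop_injective (funext fun φ => reflectWeight_reflectWeight Γ s φ)
  rw [racgMatrix_apply]
  split_ifs with h₁ h₂
  · subst h₁
    rw [pow_one, hsq]
  · have hc : reflectWeightEnd Γ s * reflectWeightEnd Γ t =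
        reflectWeightEnd Γ t * reflectWeightEnd Γ s :=
      MulOpposite.unop_injective (funext fun φ => reflectWeight_comm Γ h₂.symm φ)
    rw [pow_two, mul_assoc, ← mul_assoc (reflectWeightEnd Γ t), ← hc, mul_assoc, hsq, mul_one,
      hsq]
  · rw [pow_zero]

/-- The weights reached along a word thus depend only on the group element it represents. The
opposite monoid makes the first letter act first. -/
theorem foldl_reflectWeight_eq (w : List V) (φ : V → ℤ) :
    w.foldl (fun ψ s => reflectWeight Γ s ψ) φ =
      ((racgSystem Γ).lift ⟨_, isLiftable_reflectWeightEnd Γ⟩ ((racgSystem Γ).wordProd w)).unop φ := by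
  induction w generalizing φ with
  | nil => simp; rfl
  | cons s w ih =>
    rw [List.foldl_cons, ih, CoxeterSystem.wordProd_cons, map_mul,
      CoxeterSystem.lift_apply_simple]
    rfl

/-- The weights reached from the constant weight `1` by an admissible word are positive off the
descent set, and a negative weight is outweighed by every non-adjacent weight off the descent
set. -/
theorem weight_pos_of_admissible {w : List V} (hw : Admissible Γ ∅ w) :
    (∀ a ∈ w.foldl (descentStep Γ) ∅, ∀ b ∈ w.foldl (descentStep Γ) ∅, a ≠ b → Γ.Adj a b) ∧
    (∀ b ∉ w.foldl (descentStep Γ) ∅, 0 < w.foldl (fun ψ s => reflectWeight Γ s ψ) 1 b) ∧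
    (∀ a ∈ w.foldl (descentStep Γ) ∅, ∀ b ∉ w.foldl (descentStep Γ) ∅, ¬Γ.Adj a b →
      0 < w.foldl (fun ψ s => reflectWeight Γ s ψ) 1 a +
        w.foldl (fun ψ s => reflectWeight Γ s ψ) 1 b) := by
  induction w using List.reverseRecOn with
  | nil => simp
  | append_singleton w s ih =>
    obtain ⟨hw, hs⟩ := (admissible_append_singleton Γ ∅ w s).1 hw
    obtain ⟨hclique, hpos, hsum⟩ := ih hw
    simp only [List.foldl_append, List.foldl_cons, List.foldl_nil]
    generalize w.foldl (descentStep Γ) ∅ = σ at *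
    generalize w.foldl (fun ψ s => reflectWeight Γ s ψ) 1 = φ at *
    have hmem : ∀ b, b ∈ descentStep Γ σ s ↔ b = s ∨ b ∈ σ ∧ Γ.Adj s b := fun b => Iff.rfl
    have hφs := hpos s hs
    refine ⟨?_, ?_, ?_⟩
    · intro a ha b hb hab
      rcases (hmem a).1 ha with rfl | ⟨ha, ha'⟩ <;> rcases (hmem b).1 hb with rfl | ⟨hb, hb'⟩
      · exact absurd rfl hab
      · exact hb'
      · exact ha'.symm
      · exact hclique a ha b hb hab
    · intro b hb
      rw [hmem, not_or, not_and] at hb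
      by_cases hadj : Γ.Adj s b
      · rw [reflectWeight_of_adj Γ hadj]
        exact hpos b fun h => hb.2 h hadj
      · rw [reflectWeight_of_not_adj Γ hb.1 hadj]
        by_cases hbσ : b ∈ σ
        · have := hsum b hbσ s hs fun h => hadj h.symm
          omega
        · have := hpos b hbσ
          omega
    · intro a ha b hb hab
      rw [hmem, not_or, not_and] at hb
      rcases (hmem a).1 ha with rfl | ⟨ha, ha'⟩
      · rw [reflectWeight_self, reflectWeight_of_not_adj Γ hb.1 hab]
        by_cases hbσ : b ∈ σ
        · have := hsum b hbσ a hs fun h => hab h.symm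
          omega
        · have := hpos b hbσ
          omega
      · rw [reflectWeight_of_adj Γ ha']
        by_cases hadj : Γ.Adj s b
        · rw [reflectWeight_of_adj Γ hadj]
          exact hsum a ha b (fun h => hb.2 h hadj) hab
        · rw [reflectWeight_of_not_adj Γ hb.1 hadj]
          -- The old state is a clique, so a `b` in it would be adjacent or equal to `a`, and either
          -- is excluded.
          have hbσ : b ∉ σ := fun h =>
            hab (hclique a ha b h fun hab' => hadj (hab' ▸ ha'))
          have := hsum a ha b hbσ hab
          omega

/-- The sign of a weight detects whether appending `s` lengthens the element. If `w s` were shorter,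
`w` would also have a reduced expression ending in `s`, making its weight at `s` negative, while
admissibility of `w` followed by `s` makes that weight positive. -/
theorem isReduced_of_admissible {w : List V} (hw : Admissible Γ ∅ w) :
    (racgSystem Γ).IsReduced w := by
  induction w using List.reverseRecOn with
  | nil => simp [CoxeterSystem.IsReduced]
  | append_singleton w s ih =>
    obtain ⟨hw, hs⟩ := (admissible_append_singleton Γ ∅ w s).1 hw
    have hlen := (ih hw).eq
    rw [CoxeterSystem.IsReduced, CoxeterSystem.wordProd_append, CoxeterSystem.wordProd_singleton,
      List.length_append, List.length_singleton]
    rcases (racgSystem Γ).length_mul_simple ((racgSystem Γ).wordProd w) s with h | h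
    · omega
    exfalso
    obtain ⟨u, hu, hprod⟩ := (racgSystem Γ).exists_isReduced
      ((racgSystem Γ).wordProd w * (racgSystem Γ).simple s)
    have hprod' : (racgSystem Γ).wordProd (u ++ [s]) = (racgSystem Γ).wordProd w := by
      rw [CoxeterSystem.wordProd_append, CoxeterSystem.wordProd_singleton, ← hprod,
        CoxeterSystem.simple_mul_simple_cancel_right]
    have hus : (racgSystem Γ).IsReduced (u ++ [s]) := by
      have := hu.eq
      rw [← hprod] at this
      rw [CoxeterSystem.IsReduced, hprod', List.length_append, List.length_singleton]
      omega
    obtain ⟨hu', hsu⟩ := (admissible_append_singleton Γ ∅ u s).1 (admissible_of_isReduced Γ hus)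
    have h₁ := (weight_pos_of_admissible Γ hu').2.1 s hsu
    have h₂ := (weight_pos_of_admissible Γ hw).2.1 s hs
    rw [foldl_reflectWeight_eq, ← hprod', ← foldl_reflectWeight_eq, List.foldl_append,
      List.foldl_cons, List.foldl_nil, reflectWeight_self] at h₂
    omega

theorem mem_racgGeodesics_iff (w : List V) : w ∈ racgGeodesics Γ ↔ Admissible Γ ∅ w :=
  ⟨fun h => admissible_of_isReduced Γ (Eq.symm h), fun h => (isReduced_of_admissible Γ h).symm⟩

end Geodesics

/-! ### The linear system satisfied by the growth series of a triangle-free graph -/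

section Counting

open PowerSeries

variable {V : Type*} [Fintype V] (Γ : SimpleGraph V)

open Classical in
/-- The finite set of admissible words of length `n` from the descent set `σ`. -/
noncomputable def admissibleWords : ℕ → Set V → Finset (List V)
  | 0, _ => {[]}
  | n + 1, σ => (Finset.univ.filter (· ∉ σ)).biUnion fun a =>
      (admissibleWords n (descentStep Γ σ a)).image (List.cons a)

theorem mem_admissibleWords (n : ℕ) (σ : Set V) (l : List V) :
    l ∈ admissibleWords Γ n σ ↔ Admissible Γ σ l ∧ l.length = n := by
  induction n generalizing σ l with
  | zero => cases l <;> simp [admissibleWords, Admissible]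
  | succ n ih => cases l <;> simp [admissibleWords, Admissible, ih, and_assoc]

theorem strictGrowth_racgGeodesics (n : ℕ) :
    strictGrowth (racgGeodesics Γ) n = (admissibleWords Γ n ∅).card := by
  rw [strictGrowth, ← Set.ncard_coe_finset]
  congr 1
  ext l
  simp [mem_admissibleWords, mem_racgGeodesics_iff]

open Classical in
theorem card_admissibleWords_succ (n : ℕ) (σ : Set V) :
    ((admissibleWords Γ (n + 1) σ).card : ℤ) =
      ∑ a, if a ∈ σ then 0 else ((admissibleWords Γ n (descentStep Γ σ a)).card : ℤ) := by
  rw [admissibleWords, Finset.card_biUnion]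
  · rw [Finset.sum_filter, Nat.cast_sum]
    refine Finset.sum_congr rfl fun a _ => ?_
    by_cases h : a ∈ σ
    · simp [h]
    · simp [h, Finset.card_image_of_injective _ (List.cons_injective (a := a))]
  · intro a _ b _ hab
    simp only [Function.onFun]
    rw [Finset.disjoint_left]
    simp only [Finset.mem_image]
    rintro _ ⟨l, -, rfl⟩ ⟨l', -, h⟩
    exact hab (List.cons.inj h).1.symm

/-- The generating series of the admissible words from the descent set `σ`. -/
noncomputable def admissibleSeries (σ : Set V) : ℤ⟦X⟧ :=
  PowerSeries.mk fun n => ((admissibleWords Γ n σ).card : ℤ)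

theorem map_geodesicGrowthSeries :
    PowerSeries.map (Nat.castRingHom ℤ) (geodesicGrowthSeries Γ) = admissibleSeries Γ ∅ := by
  ext n
  simp [geodesicGrowthSeries, admissibleSeries, strictGrowth_racgGeodesics]

-- Nonempty words are split by their first letter.
open Classical in
theorem admissibleSeries_eq (σ : Set V) :
    admissibleSeries Γ σ =
      1 + X * ∑ a, if a ∈ σ then 0 else admissibleSeries Γ (descentStep Γ σ a) := by
  ext n
  cases n with
  | zero => simp [admissibleSeries, admissibleWords]
  | succ n =>
    rw [map_add, coeff_succ_X_mul, map_sum, admissibleSeries, coeff_mk, card_admissibleWords_succ,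
      coeff_one, if_neg n.succ_ne_zero, zero_add]
    refine Finset.sum_congr rfl fun a _ => ?_
    split_ifs <;> simp [admissibleSeries]

open Classical in
/-- The correction to the sum of all the series `admissibleSeries Γ {a}` that is due to the
neighbours of `v`. -/
noncomputable def linkDefect (v : V) : ℤ⟦X⟧ :=
  ∑ a, if Γ.Adj v a then admissibleSeries Γ {a, v} - admissibleSeries Γ {a} else 0

theorem admissibleSeries_empty :
    admissibleSeries Γ ∅ = 1 + X * ∑ a, admissibleSeries Γ {a} := by
  classical
  rw [admissibleSeries_eq]
  congr 2
  refine Finset.sum_congr rfl fun a _ => ?_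
  simp [descentStep]

theorem admissibleSeries_singleton (v : V) :
    admissibleSeries Γ {v} =
      1 + X * (∑ a, admissibleSeries Γ {a} - admissibleSeries Γ {v} + linkDefect Γ v) := by
  classical
  -- Written as a sum supported at `v`, the subtracted term allows a comparison letter by letter.
  have hv : admissibleSeries Γ {v} = ∑ a, if a = v then admissibleSeries Γ {v} else 0 := by simp
  conv_lhs => rw [admissibleSeries_eq]
  conv_rhs => rw [hv]
  rw [linkDefect, ← Finset.sum_sub_distrib, ← Finset.sum_add_distrib]
  congr 2
  refine Finset.sum_congr rfl fun a _ => ?_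
  by_cases h : a = v
  · simp [h]
  · by_cases h' : Γ.Adj v a
    · have : descentStep Γ {v} a = {a, v} := by
        ext b
        simp only [descentStep, Set.mem_insert_iff, Set.mem_ofPred_eq, Set.mem_singleton_iff]
        refine or_congr_right ⟨fun hb => hb.1, fun hb => ⟨hb, hb ▸ h'.symm⟩⟩
      simp [h, h', this]
    · have : descentStep Γ {v} a = {a} := by
        ext b
        simp only [descentStep, Set.mem_insert_iff, Set.mem_ofPred_eq, Set.mem_singleton_iff]
        refine or_iff_left fun hb => h' (hb.1 ▸ hb.2).symm
      simp [h, h', this]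

/-- No letter is adjacent to both `u` and `v`, so a new letter keeps at most one of them and the
corrections at `u` and `v` add up. The forbidden letters `u` and `v` occur in each other's defect,
which accounts for the multiple `2` of the pair series. -/
theorem admissibleSeries_pair (hΓ : Γ.CliqueFree 3) {u v : V} (huv : Γ.Adj u v) :
    admissibleSeries Γ {u, v} =
      1 + X * (∑ a, admissibleSeries Γ {a} - 2 * admissibleSeries Γ {u, v} +
        linkDefect Γ u + linkDefect Γ v) := by
  classical
  have hu : admissibleSeries Γ {u, v} =
      ∑ a, if a = u then admissibleSeries Γ {u, v} else 0 := by simp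
  have hv : admissibleSeries Γ {u, v} =
      ∑ a, if a = v then admissibleSeries Γ {u, v} else 0 := by simp
  have h2 : 2 * admissibleSeries Γ {u, v} =
      ∑ a, ((if a = u then admissibleSeries Γ {u, v} else 0) +
        if a = v then admissibleSeries Γ {u, v} else 0) := by
    rw [Finset.sum_add_distrib, ← hu, ← hv, two_mul]
  conv_lhs => rw [admissibleSeries_eq]
  rw [h2, linkDefect, linkDefect, ← Finset.sum_sub_distrib, ← Finset.sum_add_distrib,
    ← Finset.sum_add_distrib]
  congr 2
  refine Finset.sum_congr rfl fun a _ => ?_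
  have hmem : ∀ b, b ∈ descentStep Γ {u, v} a ↔ b = a ∨ (b = u ∨ b = v) ∧ Γ.Adj a b :=
    fun b => Iff.rfl
  -- The letter `u` is forbidden: its term in the full sum is cancelled by that in `linkDefect Γ v`,
  -- up to one copy of the pair series.
  by_cases hau : a = u
  · subst hau
    simp [huv.ne, huv.symm]
  by_cases hav : a = v
  · subst hav
    simp [huv.ne', huv, Set.pair_comm a u]
  by_cases hadju : Γ.Adj u a
  · have hadjv : ¬Γ.Adj v a := fun h =>
      hΓ {u, v, a} (SimpleGraph.is3Clique_triple_iff.2 ⟨huv, hadju, h⟩)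
    have : descentStep Γ {u, v} a = {a, u} := by
      ext b
      rw [hmem]
      refine or_congr_right ⟨?_, fun hb => ?_⟩
      · rintro ⟨rfl | rfl, h⟩
        · rfl
        · exact absurd h.symm hadjv
      · obtain rfl : b = u := hb
        exact ⟨Or.inl rfl, hadju.symm⟩
    simp [hau, hav, hadju, hadjv, this]
  · by_cases hadjv : Γ.Adj v a
    · have : descentStep Γ {u, v} a = {a, v} := by
        ext b
        rw [hmem]
        refine or_congr_right ⟨?_, fun hb => ?_⟩
        · rintro ⟨rfl | rfl, h⟩
          · exact absurd h.symm hadju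
          · rfl
        · obtain rfl : b = v := hb
          exact ⟨Or.inr rfl, hadjv.symm⟩
      simp [hau, hav, hadju, hadjv, this]
    · have : descentStep Γ {u, v} a = {a} := by
        ext b
        rw [hmem]
        refine or_iff_left ?_
        rintro ⟨rfl | rfl, h⟩
        · exact hadju h.symm
        · exact hadjv h.symm
      simp [hau, hav, hadju, hadjv, this]

open Classical in
/-- The contribution of the neighbours of `v` to the generalized Laplacian at `v`. -/
noncomputable def linkSum (x : V → ℤ⟦X⟧) (v : V) : ℤ⟦X⟧ :=
  ∑ a, if Γ.Adj v a then (1 + X) * x v - X * x a else 0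

/-- The vector `x` satisfies, at the vertex `v`, the equation
`((1 + t) (1 + 2 t) - t (1 + t) deg + t² adj) x = k` of the generalized Laplacian. -/
def LaplaceEq (k : ℤ⟦X⟧) (x : V → ℤ⟦X⟧) (v : V) : Prop :=
  (1 + X) * (1 + 2 * X) * x v = k + X * linkSum Γ x v

theorem laplaceEq_admissibleSeries_sub_linkDefect (hΓ : Γ.CliqueFree 3) (v : V) :
    LaplaceEq Γ ((1 + X) * (1 + 2 * X) * admissibleSeries Γ ∅)
      (fun v => admissibleSeries Γ ∅ - linkDefect Γ v) v := by
  classical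
  have h : (1 + X) * (1 + 2 * X) * linkDefect Γ v =
      -X * linkSum Γ (fun v => admissibleSeries Γ ∅ - linkDefect Γ v) v := by
    conv_lhs => rw [linkDefect]
    rw [linkSum, Finset.mul_sum, Finset.mul_sum]
    refine Finset.sum_congr rfl fun a _ => ?_
    by_cases hva : Γ.Adj v a
    · rw [if_pos hva, if_pos hva]
      -- The coefficients clear the denominators `1 + 2X` of the pair series and `1 + X` of the
      -- singleton series; the last term eliminates the sum over all letters.
      linear_combination (1 + X) * admissibleSeries_pair Γ hΓ hva.symm -
        (1 + 2 * X) * admissibleSeries_singleton Γ a + X * admissibleSeries_empty Γ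
    · rw [if_neg hva, if_neg hva, mul_zero, mul_zero]
  rw [LaplaceEq]
  linear_combination -h

/-- This recovers the growth series from the solution of the Laplacian system, through its
coordinate sum alone. -/
theorem admissibleSeries_empty_eq_sum :
    (1 + X) * (admissibleSeries Γ ∅ - 1) =
      X * ((Fintype.card V : ℤ⟦X⟧) * (1 + X) * admissibleSeries Γ ∅ -
        X * ∑ v, (admissibleSeries Γ ∅ - linkDefect Γ v)) := by
  have h : (1 + X) * ∑ v, admissibleSeries Γ {v} =
      (Fintype.card V : ℤ⟦X⟧) * admissibleSeries Γ ∅ + X * ∑ v, linkDefect Γ v := by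
    have h' : ∀ v, (1 + X) * admissibleSeries Γ {v} =
        admissibleSeries Γ ∅ + X * linkDefect Γ v := fun v => by
      linear_combination admissibleSeries_singleton Γ v - admissibleSeries_empty Γ
    rw [Finset.mul_sum, Finset.sum_congr rfl fun v _ => h' v, Finset.sum_add_distrib,
      ← Finset.mul_sum, Finset.sum_const, Finset.card_univ, nsmul_eq_mul]
  rw [Finset.sum_sub_distrib, Finset.sum_const, Finset.card_univ, nsmul_eq_mul]
  linear_combination (1 + X) * admissibleSeries_empty Γ + X * h

end Counting

/-! ### Coalescences with rooted graphs that have the same root elimination -/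

section Coalescence

open PowerSeries

variable {V W : Type*}

theorem cliqueFree_three_iff (Γ : SimpleGraph V) :
    Γ.CliqueFree 3 ↔ ∀ a b c, Γ.Adj a b → Γ.Adj a c → Γ.Adj b c → False := by
  classical
  refine ⟨fun h a b c hab hac hbc => h {a, b, c} (SimpleGraph.is3Clique_triple_iff.2
    ⟨hab, hac, hbc⟩), fun h s hs => ?_⟩
  obtain ⟨a, b, c, hab, hac, hbc, -⟩ := SimpleGraph.is3Clique_iff.1 hs
  exact h a b c hab hac hbc

/-- The two sides meet only in the root, so every triangle lies within one of the two graphs. -/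
theorem cliqueFree_three_coalescence {τ : SimpleGraph V} (hτ : τ.CliqueFree 3) (r : V)
    {σ : SimpleGraph W} (hσ : σ.CliqueFree 3) (s : W) : (coalescence τ r σ s).CliqueFree 3 := by
  rw [cliqueFree_three_iff] at hτ hσ ⊢
  rintro (a | a) (b | b) (c | c) hab hac hbc
  · exact hτ a b c hab hac hbc
  · obtain ⟨rfl, -⟩ := hac
    obtain ⟨rfl, -⟩ := hbc
    exact τ.irrefl hab
  · obtain ⟨rfl, -⟩ := hab
    obtain ⟨rfl, -⟩ := hbc
    exact τ.irrefl hac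
  · exact hσ s b c hab.2 hac.2 hbc
  · obtain ⟨rfl, -⟩ := hab
    obtain ⟨rfl, -⟩ := hac
    exact τ.irrefl hbc
  · exact hσ s a c hab.2 hbc.2 hac
  · exact hσ s a b hac.2 hbc.2 hab
  · exact hσ a b c hab hac hbc

open Classical in
/-- The embedding of the second graph into a coalescence. -/
noncomputable def coalescenceInr (r : V) (s : W) (w : W) : V ⊕ {w : W // w ≠ s} :=
  if h : w = s then .inl r else .inr ⟨w, h⟩

@[simp]
theorem coalescenceInr_root (r : V) (s : W) : coalescenceInr r s s = .inl r := by
  simp [coalescenceInr]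

@[simp]
theorem coalescenceInr_coe (r : V) (s : W) (w : {w : W // w ≠ s}) :
    coalescenceInr r s w = .inr w := by
  simp [coalescenceInr, w.2]

variable [Fintype V] [Fintype W] [DecidableEq W]

variable (τ : SimpleGraph V) (r : V) (σ : SimpleGraph W) (s : W)
  (x : V ⊕ {w : W // w ≠ s} → ℤ⟦X⟧)

theorem linkSum_coalescence_inr (w : {w : W // w ≠ s}) :
    linkSum (coalescence τ r σ s) x (.inr w) = linkSum σ (x ∘ coalescenceInr r s) w := by
  classical
  rw [linkSum, linkSum, Fintype.sum_sum_type, Fintype.sum_eq_add_sum_subtype_ne _ s]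
  congr 1
  · rw [Finset.sum_eq_single r]
    · simp [coalescence, σ.adj_comm]
    · intro a _ ha
      simp [coalescence, ha]
    · simp
  · refine Finset.sum_congr rfl fun a _ => ?_
    simp [coalescence]
    rfl

theorem linkSum_coalescence_inl_of_ne {v : V} (hv : v ≠ r) :
    linkSum (coalescence τ r σ s) x (.inl v) = linkSum τ (x ∘ Sum.inl) v := by
  classical
  rw [linkSum, linkSum, Fintype.sum_sum_type]
  simp [coalescence, hv]
  rfl

theorem linkSum_coalescence_inl_root :
    linkSum (coalescence τ r σ s) x (.inl r) =
      linkSum τ (x ∘ Sum.inl) r + linkSum σ (x ∘ coalescenceInr r s) s := by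
  classical
  rw [linkSum, linkSum, linkSum, Fintype.sum_sum_type, Fintype.sum_eq_add_sum_subtype_ne _ s]
  simp [coalescence]
  rfl

/-- Eliminating the vertices other than the root `s` from the generalized Laplacian system of `σ`
gives the relations with coefficients `p`, `q` for the contribution of the neighbours of the root
and `m`, `n` for the sum of the unknowns, both up to the factor `D`. -/
def RootElimination (D p q m n : ℤ⟦X⟧) : Prop :=
  ∀ (k : ℤ⟦X⟧) (x : W → ℤ⟦X⟧), (∀ w, w ≠ s → LaplaceEq σ k x w) →
    D * linkSum σ x s = p * k + q * x s ∧
    D * ∑ w : {w : W // w ≠ s}, x w = m * k + n * x s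

theorem linkSum_sub {U : Type*} [Fintype U] (Γ : SimpleGraph U) (x y : U → ℤ⟦X⟧) (v : U) :
    linkSum Γ (x - y) v = linkSum Γ x v - linkSum Γ y v := by
  classical
  rw [linkSum, linkSum, linkSum, ← Finset.sum_sub_distrib]
  refine Finset.sum_congr rfl fun a _ => ?_
  split_ifs
  · simp only [Pi.sub_apply]; ring
  · ring

theorem dvd_linkSum {U : Type*} [Fintype U] (Γ : SimpleGraph U) {d : ℤ⟦X⟧} {x : U → ℤ⟦X⟧}
    (h : ∀ v, d ∣ x v) (v : U) : d ∣ linkSum Γ x v := by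
  classical
  refine Finset.dvd_sum fun a _ => ?_
  split_ifs
  · exact dvd_sub ((h v).mul_left _) ((h a).mul_left _)
  · exact dvd_zero d

/-- A homogeneous system that is the identity modulo `X`, up to units, has only the zero
solution. -/
theorem eq_zero_of_forall_dvd {ι : Type*} {z : ι → ℤ⟦X⟧}
    (h : ∀ d, (∀ i, d ∣ z i) → ∀ i, X * d ∣ z i) (i : ι) : z i = 0 := by
  have hn : ∀ n : ℕ, ∀ i, X ^ n ∣ z i := by
    intro n
    induction n with
    | zero => simp
    | succ n ih => rw [pow_succ']; exact h _ ih
  ext n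
  exact X_pow_dvd_iff.1 (hn (n + 1) i) n n.lt_succ_self

/-- After elimination both solutions satisfy the same system on the vertices of `τ`. Their
difference solves the homogeneous system and vanishes by `X`-adic descent; the remaining coordinates
enter only through their sum, which the root value determines. -/
theorem sum_eq_of_rootElimination {σ₁ σ₂ : SimpleGraph W} {D p q m n : ℤ⟦X⟧}
    (hD : constantCoeff D = 1) (h₁ : RootElimination σ₁ s D p q m n)
    (h₂ : RootElimination σ₂ s D p q m n) {k : ℤ⟦X⟧} {x y : V ⊕ {w : W // w ≠ s} → ℤ⟦X⟧}
    (hx : ∀ v, LaplaceEq (coalescence τ r σ₁ s) k x v)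
    (hy : ∀ v, LaplaceEq (coalescence τ r σ₂ s) k y v) : ∑ v, x v = ∑ v, y v := by
  have hinr : ∀ (σ : SimpleGraph W) (x : V ⊕ {w : W // w ≠ s} → ℤ⟦X⟧),
      (∀ v, LaplaceEq (coalescence τ r σ s) k x v) →
      ∀ w, w ≠ s → LaplaceEq σ k (x ∘ coalescenceInr r s) w := by
    intro σ x hx w hw
    have := hx (.inr ⟨w, hw⟩)
    rw [LaplaceEq, linkSum_coalescence_inr] at this
    rw [LaplaceEq, ← this]
    simp [coalescenceInr, hw]
  obtain ⟨hx₁, hx₂⟩ := h₁ k _ (hinr σ₁ x hx)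
  obtain ⟨hy₁, hy₂⟩ := h₂ k _ (hinr σ₂ y hy)
  simp only [Function.comp_apply, coalescenceInr_root, coalescenceInr_coe] at hx₁ hx₂ hy₁ hy₂
  have hκ : IsUnit ((1 + X) * (1 + 2 * X) : ℤ⟦X⟧) := by
    rw [isUnit_iff_constantCoeff]; simp
  have hDκ : IsUnit (D * ((1 + X) * (1 + 2 * X)) : ℤ⟦X⟧) := by
    rw [isUnit_iff_constantCoeff]; simp [hD]
  have hz : ∀ v, (x ∘ Sum.inl - y ∘ Sum.inl : V → ℤ⟦X⟧) v = 0 := by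
    refine eq_zero_of_forall_dvd fun d hd v => ?_
    have hsum := dvd_linkSum τ hd
    simp only [linkSum_sub] at hsum
    by_cases hv : v = r
    · subst hv
      have hxv := hx (.inl v)
      have hyv := hy (.inl v)
      rw [LaplaceEq, linkSum_coalescence_inl_root] at hxv hyv
      rw [← hDκ.dvd_mul_left]
      have : D * ((1 + X) * (1 + 2 * X)) * (x ∘ Sum.inl - y ∘ Sum.inl : V → ℤ⟦X⟧) v =
          X * (D * (linkSum τ (x ∘ Sum.inl) v - linkSum τ (y ∘ Sum.inl) v) +
            q * (x ∘ Sum.inl - y ∘ Sum.inl : V → ℤ⟦X⟧) v) := by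
        simp only [Pi.sub_apply, Function.comp_apply]
        linear_combination D * hxv - D * hyv + X * hx₁ - X * hy₁
      rw [this]
      exact mul_dvd_mul_left X (dvd_add ((hsum v).mul_left _) ((hd v).mul_left _))
    · have hxv := hx (.inl v)
      have hyv := hy (.inl v)
      rw [LaplaceEq, linkSum_coalescence_inl_of_ne _ _ _ _ _ hv] at hxv hyv
      rw [← hκ.dvd_mul_left]
      have : (1 + X) * (1 + 2 * X) * (x ∘ Sum.inl - y ∘ Sum.inl : V → ℤ⟦X⟧) v =
          X * (linkSum τ (x ∘ Sum.inl) v - linkSum τ (y ∘ Sum.inl) v) := by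
        simp only [Pi.sub_apply, Function.comp_apply]
        linear_combination hxv - hyv
      rw [this]
      exact mul_dvd_mul_left X (hsum v)
  have hxy : ∀ v, x (.inl v) = y (.inl v) := fun v => sub_eq_zero.1 (hz v)
  rw [Fintype.sum_sum_type, Fintype.sum_sum_type]
  congr 1
  · exact Finset.sum_congr rfl fun v _ => hxy v
  · have hD0 : IsUnit D := by rw [isUnit_iff_constantCoeff, hD]; exact isUnit_one
    refine hD0.mul_left_cancel ?_
    rw [hx₂, hy₂, hxy]

theorem LaplaceEq.mul_left {U : Type*} [Fintype U] {Γ : SimpleGraph U} {k : ℤ⟦X⟧}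
    {x : U → ℤ⟦X⟧} {v : U} (h : LaplaceEq Γ k x v) (c : ℤ⟦X⟧) :
    LaplaceEq Γ (c * k) (fun v => c * x v) v := by
  classical
  have hs : linkSum Γ (fun v => c * x v) v = c * linkSum Γ x v := by
    rw [linkSum, linkSum, Finset.mul_sum]
    refine Finset.sum_congr rfl fun a _ => ?_
    split_ifs <;> ring
  rw [LaplaceEq] at h ⊢
  rw [hs]
  linear_combination c * h

/-- Rooted triangle-free graphs with the same root elimination are interchangeable in a coalescence
as far as the geodesic growth series is concerned. -/
theorem geodesicGrowthSeries_coalescence_eq (hτ : τ.CliqueFree 3) {σ₁ σ₂ : SimpleGraph W}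
    (hσ₁ : σ₁.CliqueFree 3) (hσ₂ : σ₂.CliqueFree 3) {D p q m n : ℤ⟦X⟧}
    (hD : constantCoeff D = 1) (h₁ : RootElimination σ₁ s D p q m n)
    (h₂ : RootElimination σ₂ s D p q m n) :
    geodesicGrowthSeries (coalescence τ r σ₁ s) = geodesicGrowthSeries (coalescence τ r σ₂ s) := by
  refine PowerSeries.map_injective (Nat.castRingHom ℤ) Nat.cast_injective ?_
  rw [map_geodesicGrowthSeries, map_geodesicGrowthSeries]
  have e₁ := laplaceEq_admissibleSeries_sub_linkDefect _
    (cliqueFree_three_coalescence hτ r hσ₁ s)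
  have e₂ := laplaceEq_admissibleSeries_sub_linkDefect _
    (cliqueFree_three_coalescence hτ r hσ₂ s)
  have s₁ := admissibleSeries_empty_eq_sum (coalescence τ r σ₁ s)
  have s₂ := admissibleSeries_empty_eq_sum (coalescence τ r σ₂ s)
  set c₁ := admissibleSeries (coalescence τ r σ₁ s) ∅
  set c₂ := admissibleSeries (coalescence τ r σ₂ s) ∅
  -- The right-hand sides involve the unknown `c₁` and `c₂`. Scaling each system by the other series
  -- makes them equal without division.
  have h := sum_eq_of_rootElimination (k := (1 + X) * (1 + 2 * X) * c₁ * c₂) τ r s hD h₁ h₂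
    (fun v => by have := (e₁ v).mul_left c₂; rwa [mul_comm] at this)
    (fun v => by
      have := (e₂ v).mul_left c₁
      rwa [mul_left_comm, ← mul_assoc] at this)
  rw [← Finset.mul_sum, ← Finset.mul_sum] at h
  have hX : IsUnit (1 + X : ℤ⟦X⟧) := by rw [isUnit_iff_constantCoeff]; simp
  refine hX.mul_left_cancel ?_
  -- Cross-multiplication cancels the vertex-count terms, as both graphs have the same vertices, and
  -- leaves `(1 + X) (c₁ - c₂) = 0`.
  linear_combination c₂ * s₁ - c₁ * s₂ - X ^ 2 * h

end Coalescence

/-! ### The root elimination of the trees of McKay -/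

section McKay

open PowerSeries

/-- The common denominator of the root eliminations of the trees of McKay. -/
noncomputable def mckayDenominator : ℤ⟦X⟧ :=
  (1 + X) * (1 + 8 * X + 26 * X ^ 2 + 40 * X ^ 3 + 6 * X ^ 4 - 105 * X ^ 5 - 226 * X ^ 6 -
    204 * X ^ 7 + 27 * X ^ 8 + 312 * X ^ 9 + 393 * X ^ 10 + 208 * X ^ 11 - 37 * X ^ 12 -
    133 * X ^ 13 - 76 * X ^ 14 - 7 * X ^ 15 + 12 * X ^ 16 + 3 * X ^ 17)

/-- The numerator of `bᵀ M⁻¹ b`, where `M` is the generalized Laplacian of a tree of McKay off its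
root and `b` the indicator function of the neighbours of the root. -/
noncomputable def mckayRootRoot : ℤ⟦X⟧ :=
  (2 + 17 * X + 61 * X ^ 2 + 115 * X ^ 3 + 90 * X ^ 4 - 106 * X ^ 5 - 400 * X ^ 6 - 518 * X ^ 7 -
    264 * X ^ 8 + 189 * X ^ 9 + 429 * X ^ 10 + 288 * X ^ 11 + 11 * X ^ 12 - 112 * X ^ 13 -
    63 * X ^ 14 - 3 * X ^ 15 + 8 * X ^ 16)

/-- The numerator of `bᵀ M⁻¹ 1`, with `M` and `b` as in `mckayRootRoot`. -/
noncomputable def mckayRootSum : ℤ⟦X⟧ :=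
  (1 + X) * (2 + 15 * X + 43 * X ^ 2 + 48 * X ^ 3 - 35 * X ^ 4 - 189 * X ^ 5 - 253 * X ^ 6 -
    81 * X ^ 7 + 211 * X ^ 8 + 330 * X ^ 9 + 174 * X ^ 10 - 46 * X ^ 11 - 107 * X ^ 12 -
    45 * X ^ 13 + 6 * X ^ 14 + 7 * X ^ 15)

/-- The numerator of `1ᵀ M⁻¹ 1`, with `M` as in `mckayRootRoot`. -/
noncomputable def mckaySumSum : ℤ⟦X⟧ :=
  (15 + 118 * X + 356 * X ^ 2 + 422 * X ^ 3 - 296 * X ^ 4 - 1746 * X ^ 5 - 2466 * X ^ 6 -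
    880 * X ^ 7 + 2179 * X ^ 8 + 3760 * X ^ 9 + 2377 * X ^ 10 - 158 * X ^ 11 - 1259 * X ^ 12 -
    744 * X ^ 13 - 50 * X ^ 14 + 106 * X ^ 15 + 26 * X ^ 16)

theorem sum_ne_zero_fin_sixteen (x : Fin 16 → ℤ⟦X⟧) :
    ∑ w : {w : Fin 16 // w ≠ 0}, x w = x 1 + x 2 + x 3 + x 4 + x 5 + x 6 + x 7 + x 8 + x 9 +
      x 10 + x 11 + x 12 + x 13 + x 14 + x 15 := by
  have h := Fintype.sum_eq_add_sum_subtype_ne x 0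
  rw [Fin.sum_univ_def] at h
  simp [List.finRange_succ] at h
  linear_combination -h

theorem rootElimination_mckayT₁ :
    RootElimination mckayT₁ 0 mckayDenominator (-X * mckayRootSum)
      (2 * (1 + X) * mckayDenominator + X ^ 3 * mckayRootRoot) mckaySumSum
      (-X ^ 2 * mckayRootSum) := by
  intro k x h
  have h1 := h 1 (by decide)
  have h2 := h 2 (by decide)
  have h3 := h 3 (by decide)
  have h4 := h 4 (by decide)
  have h5 := h 5 (by decide)
  have h6 := h 6 (by decide)
  have h7 := h 7 (by decide)
  have h8 := h 8 (by decide)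
  have h9 := h 9 (by decide)
  have h10 := h 10 (by decide)
  have h11 := h 11 (by decide)
  have h12 := h 12 (by decide)
  have h13 := h 13 (by decide)
  have h14 := h 14 (by decide)
  have h15 := h 15 (by decide)
  simp [LaplaceEq, linkSum, mckayT₁, Fin.sum_univ_succ] at h1 h2 h3 h4 h5 h6 h7 h8
  simp [LaplaceEq, linkSum, mckayT₁, Fin.sum_univ_succ] at h9 h10 h11 h12 h13 h14 h15
  refine ⟨?_, ?_⟩
  · simp [linkSum, mckayT₁, Fin.sum_univ_succ]
    unfold mckayDenominator mckayRootRoot mckayRootSum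
    -- The coefficients in parentheses are the entries of `D N⁻¹ b`, with `N` the Laplacian off the
    -- root; the factor `-X` is that of the neighbours in `linkSum`.
    linear_combination
      -X * (
        (1 + 9 * X + 35 * X ^ 2 + 75 * X ^ 3 + 83 * X ^ 4 - 8 * X ^ 5 - 194 * X ^ 6 - 342 * X ^ 7
          - 299 * X ^ 8 - 79 * X ^ 9 + 122 * X ^ 10 + 150 * X ^ 11 + 55 * X ^ 12 - 20 * X ^ 13 -
          22 * X ^ 14 - 3 * X ^ 15 + 3 * X ^ 16) * h1 +
        (1 + 8 * X + 26 * X ^ 2 + 40 * X ^ 3 + 7 * X ^ 4 - 98 * X ^ 5 - 206 * X ^ 6 - 176 * X ^ 7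
          + 35 * X ^ 8 + 268 * X ^ 9 + 307 * X ^ 10 + 138 * X ^ 11 - 44 * X ^ 12 - 92 * X ^ 13 -
          41 * X ^ 14 + 5 * X ^ 16) * h2 +
        X ^ 2 * (1 + X) ^ 2 * (-1 - 6 * X - 14 * X ^ 2 - 14 * X ^ 3 + 6 * X ^ 4 + 40 * X ^ 5 +
          56 * X ^ 6 + 34 * X ^ 7 - 5 * X ^ 8 - 24 * X ^ 9 - 13 * X ^ 10 + 3 * X ^ 12) * h3 +
        X ^ 2 * (1 + X) ^ 2 * (-1 - 6 * X - 14 * X ^ 2 - 14 * X ^ 3 + 6 * X ^ 4 + 40 * X ^ 5 +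
          56 * X ^ 6 + 34 * X ^ 7 - 5 * X ^ 8 - 24 * X ^ 9 - 13 * X ^ 10 + 3 * X ^ 12) * h4 +
        X ^ 2 * (1 + X) * (-1 - 7 * X - 20 * X ^ 2 - 28 * X ^ 3 - 8 * X ^ 4 + 44 * X ^ 5 +
          86 * X ^ 6 + 70 * X ^ 7 + 7 * X ^ 8 - 41 * X ^ 9 - 35 * X ^ 10 - 7 * X ^ 11 + 7 * X ^ 12
          + 3 * X ^ 13) * h5 +
        X ^ 4 * (1 + 6 * X + 14 * X ^ 2 + 14 * X ^ 3 - 6 * X ^ 4 - 40 * X ^ 5 - 56 * X ^ 6 -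
          34 * X ^ 7 + 5 * X ^ 8 + 24 * X ^ 9 + 13 * X ^ 10 - 3 * X ^ 12) * h6 +
        X ^ 4 * (1 + 6 * X + 14 * X ^ 2 + 14 * X ^ 3 - 6 * X ^ 4 - 40 * X ^ 5 - 56 * X ^ 6 -
          34 * X ^ 7 + 5 * X ^ 8 + 24 * X ^ 9 + 13 * X ^ 10 - 3 * X ^ 12) * h7 +
        X ^ 4 * (1 + 7 * X + 20 * X ^ 2 + 28 * X ^ 3 + 9 * X ^ 4 - 39 * X ^ 5 - 77 * X ^ 6 -
          65 * X ^ 7 - 16 * X ^ 8 + 19 * X ^ 9 + 16 * X ^ 10 + 2 * X ^ 11 - 3 * X ^ 12) * h8 +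
        X ^ 4 * (1 + X) ^ 2 * (1 + 5 * X + 9 * X ^ 2 + 5 * X ^ 3 - 10 * X ^ 4 - 24 * X ^ 5 -
          19 * X ^ 6 - 3 * X ^ 7 + 9 * X ^ 8 + 6 * X ^ 9 + X ^ 10) * h9 +
        X ^ 6 * (1 + X) ^ 2 * (-1 - 4 * X - 5 * X ^ 2 + 9 * X ^ 4 + 13 * X ^ 5 + 6 * X ^ 6 - X ^ 7
          - 3 * X ^ 8) * h10 +
        X ^ 6 * (1 + X) * (-1 - 5 * X - 9 * X ^ 2 - 5 * X ^ 3 + 9 * X ^ 4 + 20 * X ^ 5 +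
          13 * X ^ 6 - X ^ 7 - 8 * X ^ 8 - 3 * X ^ 9) * h11 +
        X ^ 8 * (1 + 4 * X + 5 * X ^ 2 - 9 * X ^ 4 - 13 * X ^ 5 - 6 * X ^ 6 + X ^ 7 +
          3 * X ^ 8) * h12 +
        X ^ 8 * (1 + X) ^ 3 * (1 + 3 * X + 3 * X ^ 2 + X ^ 3 - 2 * X ^ 4 - X ^ 5) * h13 +
        X ^ 10 * (1 + X) * (-1 - 3 * X - 3 * X ^ 2 - X ^ 3 + 2 * X ^ 4 + X ^ 5) * h14 +
        X ^ 10 * (1 + X) * (-1 - 3 * X - 3 * X ^ 2 - X ^ 3 + 2 * X ^ 4 + X ^ 5) * h15)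
  · rw [sum_ne_zero_fin_sixteen]
    unfold mckayDenominator mckayRootSum mckaySumSum
    -- Here the coefficients are the entries of `D N⁻¹ 1`.
    linear_combination
      (1 + 9 * X + 33 * X ^ 2 + 59 * X ^ 3 + 31 * X ^ 4 - 92 * X ^ 5 - 238 * X ^ 6 - 238 * X ^ 7 -
        27 * X ^ 8 + 213 * X ^ 9 + 248 * X ^ 10 + 82 * X ^ 11 - 67 * X ^ 12 - 72 * X ^ 13 -
        16 * X ^ 14 + 9 * X ^ 15 + 3 * X ^ 16) * h1 +
      (1 + 8 * X + 25 * X ^ 2 + 32 * X ^ 3 - 18 * X ^ 4 - 132 * X ^ 5 - 204 * X ^ 6 - 96 * X ^ 7 +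
        157 * X ^ 8 + 328 * X ^ 9 + 256 * X ^ 10 + 46 * X ^ 11 - 86 * X ^ 12 - 80 * X ^ 13 -
        23 * X ^ 14 + 4 * X ^ 15 + 4 * X ^ 16) * h2 +
      (1 + X) * (1 + 7 * X + 17 * X ^ 2 + 9 * X ^ 3 - 40 * X ^ 4 - 102 * X ^ 5 - 92 * X ^ 6 +
        36 * X ^ 7 + 179 * X ^ 8 + 187 * X ^ 9 + 56 * X ^ 10 - 64 * X ^ 11 - 66 * X ^ 12 -
        16 * X ^ 13 + 9 * X ^ 14 + 3 * X ^ 15) * h3 +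
      (1 + X) * (1 + 7 * X + 17 * X ^ 2 + 9 * X ^ 3 - 40 * X ^ 4 - 102 * X ^ 5 - 92 * X ^ 6 +
        36 * X ^ 7 + 179 * X ^ 8 + 187 * X ^ 9 + 56 * X ^ 10 - 64 * X ^ 11 - 66 * X ^ 12 -
        16 * X ^ 13 + 9 * X ^ 14 + 3 * X ^ 15) * h4 +
      (1 + X) * (1 + 8 * X + 24 * X ^ 2 + 27 * X ^ 3 - 22 * X ^ 4 - 108 * X ^ 5 - 130 * X ^ 6 -
        16 * X ^ 7 + 137 * X ^ 8 + 162 * X ^ 9 + 49 * X ^ 10 - 53 * X ^ 11 - 53 * X ^ 12 -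
        11 * X ^ 13 + 8 * X ^ 14 + 3 * X ^ 15) * h5 +
      (1 + 7 * X + 18 * X ^ 2 + 15 * X ^ 3 - 26 * X ^ 4 - 88 * X ^ 5 - 98 * X ^ 6 - 4 * X ^ 7 +
        123 * X ^ 8 + 153 * X ^ 9 + 61 * X ^ 10 - 40 * X ^ 11 - 53 * X ^ 12 - 16 * X ^ 13 +
        6 * X ^ 14 + 3 * X ^ 15) * h6 +
      (1 + 7 * X + 18 * X ^ 2 + 15 * X ^ 3 - 26 * X ^ 4 - 88 * X ^ 5 - 98 * X ^ 6 - 4 * X ^ 7 +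
        123 * X ^ 8 + 153 * X ^ 9 + 61 * X ^ 10 - 40 * X ^ 11 - 53 * X ^ 12 - 16 * X ^ 13 +
        6 * X ^ 14 + 3 * X ^ 15) * h7 +
      (1 + 8 * X + 24 * X ^ 2 + 25 * X ^ 3 - 35 * X ^ 4 - 142 * X ^ 5 - 171 * X ^ 6 - 13 * X ^ 7 +
        228 * X ^ 8 + 302 * X ^ 9 + 139 * X ^ 10 - 63 * X ^ 11 - 113 * X ^ 12 - 45 * X ^ 13 +
        7 * X ^ 14 + 10 * X ^ 15) * h8 +
      (1 + X) ^ 2 * (1 + 6 * X + 11 * X ^ 2 - 3 * X ^ 3 - 40 * X ^ 4 - 57 * X ^ 5 - 7 * X ^ 6 +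
        74 * X ^ 7 + 89 * X ^ 8 + 22 * X ^ 9 - 40 * X ^ 10 - 35 * X ^ 11 - 3 * X ^ 12 + 8 * X ^ 13
        + 2 * X ^ 14) * h9 +
      (1 + X) * (1 + 7 * X + 17 * X ^ 2 + 10 * X ^ 3 - 33 * X ^ 4 - 83 * X ^ 5 - 71 * X ^ 6 +
        26 * X ^ 7 + 117 * X ^ 8 + 109 * X ^ 9 + 27 * X ^ 10 - 35 * X ^ 11 - 30 * X ^ 12 -
        6 * X ^ 13 + 4 * X ^ 14) * h10 +
      (1 + X) * (1 + 7 * X + 17 * X ^ 2 + 8 * X ^ 3 - 43 * X ^ 4 - 99 * X ^ 5 - 73 * X ^ 6 +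
        54 * X ^ 7 + 163 * X ^ 8 + 139 * X ^ 9 + 27 * X ^ 10 - 47 * X ^ 11 - 38 * X ^ 12 -
        8 * X ^ 13 + 2 * X ^ 14) * h11 +
      (1 + 7 * X + 18 * X ^ 2 + 15 * X ^ 3 - 26 * X ^ 4 - 89 * X ^ 5 - 104 * X ^ 6 - 17 * X ^ 7 +
        115 * X ^ 8 + 171 * X ^ 9 + 105 * X ^ 10 - 6 * X ^ 11 - 58 * X ^ 12 - 40 * X ^ 13 -
        6 * X ^ 14 + 5 * X ^ 15 + 3 * X ^ 16) * h12 +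
      (1 + X) * (1 + 8 * X + 24 * X ^ 2 + 29 * X ^ 3 - 11 * X ^ 4 - 88 * X ^ 5 - 126 * X ^ 6 -
        57 * X ^ 7 + 64 * X ^ 8 + 117 * X ^ 9 + 66 * X ^ 10 - 12 * X ^ 11 - 32 * X ^ 12 -
        14 * X ^ 13 + 2 * X ^ 14 + X ^ 15) * h13 +
      (1 + X) * (1 + 6 * X + 12 * X ^ 2 + 2 * X ^ 3 - 34 * X ^ 4 - 68 * X ^ 5 - 45 * X ^ 6 +
        42 * X ^ 7 + 114 * X ^ 8 + 99 * X ^ 9 + 17 * X ^ 10 - 42 * X ^ 11 - 36 * X ^ 12 -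
        7 * X ^ 13 + 6 * X ^ 14 + 2 * X ^ 15) * h14 +
      (1 + X) * (1 + 6 * X + 12 * X ^ 2 + 2 * X ^ 3 - 34 * X ^ 4 - 68 * X ^ 5 - 45 * X ^ 6 +
        42 * X ^ 7 + 114 * X ^ 8 + 99 * X ^ 9 + 17 * X ^ 10 - 42 * X ^ 11 - 36 * X ^ 12 -
        7 * X ^ 13 + 6 * X ^ 14 + 2 * X ^ 15) * h15

/-- The certificates are again `D N⁻¹ b` and `D N⁻¹ 1`. They differ from those of the first tree,
but their pairings with `b` and `1` agree. -/
theorem rootElimination_mckayT₂ :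
    RootElimination mckayT₂ 0 mckayDenominator (-X * mckayRootSum)
      (2 * (1 + X) * mckayDenominator + X ^ 3 * mckayRootRoot) mckaySumSum
      (-X ^ 2 * mckayRootSum) := by
  intro k x h
  have h1 := h 1 (by decide)
  have h2 := h 2 (by decide)
  have h3 := h 3 (by decide)
  have h4 := h 4 (by decide)
  have h5 := h 5 (by decide)
  have h6 := h 6 (by decide)
  have h7 := h 7 (by decide)
  have h8 := h 8 (by decide)
  have h9 := h 9 (by decide)
  have h10 := h 10 (by decide)
  have h11 := h 11 (by decide)
  have h12 := h 12 (by decide)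
  have h13 := h 13 (by decide)
  have h14 := h 14 (by decide)
  have h15 := h 15 (by decide)
  simp [LaplaceEq, linkSum, mckayT₂, Fin.sum_univ_succ] at h1 h2 h3 h4 h5 h6 h7 h8
  simp [LaplaceEq, linkSum, mckayT₂, Fin.sum_univ_succ] at h9 h10 h11 h12 h13 h14 h15
  refine ⟨?_, ?_⟩
  · simp [linkSum, mckayT₂, Fin.sum_univ_succ]
    unfold mckayDenominator mckayRootRoot mckayRootSum
    linear_combination
      -X * (
        (1 + 8 * X + 26 * X ^ 2 + 40 * X ^ 3 + 7 * X ^ 4 - 98 * X ^ 5 - 206 * X ^ 6 - 176 * X ^ 7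
          + 35 * X ^ 8 + 266 * X ^ 9 + 297 * X ^ 10 + 118 * X ^ 11 - 66 * X ^ 12 - 104 * X ^ 13 -
          39 * X ^ 14 + 6 * X ^ 15 + 9 * X ^ 16) * h1 +
        (1 + X) ^ 2 * (1 + 7 * X + 20 * X ^ 2 + 28 * X ^ 3 + 7 * X ^ 4 - 50 * X ^ 5 - 101 * X ^ 6
          - 90 * X ^ 7 - 18 * X ^ 8 + 49 * X ^ 9 + 52 * X ^ 10 + 17 * X ^ 11 - 9 * X ^ 12 -
          7 * X ^ 13 - X ^ 14) * h2 +
        X ^ 2 * (1 + X) ^ 2 * (-1 - 6 * X - 14 * X ^ 2 - 14 * X ^ 3 + 6 * X ^ 4 + 40 * X ^ 5 +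
          56 * X ^ 6 + 34 * X ^ 7 - 5 * X ^ 8 - 24 * X ^ 9 - 13 * X ^ 10 + 3 * X ^ 12) * h3 +
        X ^ 2 * (1 + X) * (-1 - 7 * X - 20 * X ^ 2 - 28 * X ^ 3 - 8 * X ^ 4 + 45 * X ^ 5 +
          92 * X ^ 6 + 85 * X ^ 7 + 28 * X ^ 8 - 23 * X ^ 9 - 27 * X ^ 10 - 8 * X ^ 11 +
          4 * X ^ 12 + X ^ 13) * h4 +
        X ^ 2 * (1 + X) * (-1 - 7 * X - 20 * X ^ 2 - 28 * X ^ 3 - 8 * X ^ 4 + 45 * X ^ 5 +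
          92 * X ^ 6 + 85 * X ^ 7 + 28 * X ^ 8 - 25 * X ^ 9 - 33 * X ^ 10 - 14 * X ^ 11 +
          X ^ 13) * h5 +
        X ^ 4 * (1 + 6 * X + 14 * X ^ 2 + 14 * X ^ 3 - 6 * X ^ 4 - 40 * X ^ 5 - 56 * X ^ 6 -
          34 * X ^ 7 + 5 * X ^ 8 + 24 * X ^ 9 + 13 * X ^ 10 - 3 * X ^ 12) * h6 +
        X ^ 4 * (1 + 6 * X + 14 * X ^ 2 + 14 * X ^ 3 - 6 * X ^ 4 - 40 * X ^ 5 - 56 * X ^ 6 -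
          34 * X ^ 7 + 5 * X ^ 8 + 24 * X ^ 9 + 13 * X ^ 10 - 3 * X ^ 12) * h7 +
        X ^ 4 * (1 + X) ^ 3 * (1 + 4 * X + 5 * X ^ 2 - 10 * X ^ 4 - 16 * X ^ 5 - 9 * X ^ 6 +
          5 * X ^ 8 + X ^ 9) * h8 +
        X ^ 4 * (1 + X) ^ 2 * (1 + 5 * X + 9 * X ^ 2 + 5 * X ^ 3 - 10 * X ^ 4 - 24 * X ^ 5 -
          19 * X ^ 6 - 3 * X ^ 7 + 9 * X ^ 8 + 6 * X ^ 9 + X ^ 10) * h9 +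
        X ^ 6 * (1 + X) * (-1 - 4 * X - 5 * X ^ 2 + 10 * X ^ 4 + 16 * X ^ 5 + 9 * X ^ 6 -
          5 * X ^ 8 - X ^ 9) * h10 +
        X ^ 6 * (1 + X) * (-1 - 6 * X - 15 * X ^ 2 - 20 * X ^ 3 - 12 * X ^ 4 + 4 * X ^ 5 +
          11 * X ^ 6 + 6 * X ^ 7 - X ^ 8 - X ^ 9) * h11 +
        X ^ 8 * (1 + X) ^ 3 * (1 + 3 * X + 3 * X ^ 2 + X ^ 3 - 2 * X ^ 4 - X ^ 5) * h12 +
        X ^ 8 * (1 + X) ^ 3 * (1 + 3 * X + 3 * X ^ 2 + X ^ 3 - 2 * X ^ 4 - X ^ 5) * h13 +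
        X ^ 10 * (1 + X) * (-1 - 3 * X - 3 * X ^ 2 - X ^ 3 + 2 * X ^ 4 + X ^ 5) * h14 +
        X ^ 10 * (1 + X) * (-1 - 3 * X - 3 * X ^ 2 - X ^ 3 + 2 * X ^ 4 + X ^ 5) * h15)
  · rw [sum_ne_zero_fin_sixteen]
    unfold mckayDenominator mckayRootSum mckaySumSum
    linear_combination
      (1 + X) ^ 2 * (1 + 6 * X + 12 * X ^ 2 + 2 * X ^ 3 - 34 * X ^ 4 - 68 * X ^ 5 - 44 * X ^ 6 +
        46 * X ^ 7 + 117 * X ^ 8 + 92 * X ^ 9 + 3 * X ^ 10 - 48 * X ^ 11 - 29 * X ^ 12 +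
        6 * X ^ 14) * h1 +
      (1 + X) * (1 + 8 * X + 25 * X ^ 2 + 34 * X ^ 3 - 3 * X ^ 4 - 87 * X ^ 5 - 141 * X ^ 6 -
        83 * X ^ 7 + 48 * X ^ 8 + 121 * X ^ 9 + 79 * X ^ 10 - X ^ 11 - 30 * X ^ 12 - 16 * X ^ 13 +
        X ^ 15) * h2 +
      (1 + X) * (1 + 8 * X + 24 * X ^ 2 + 29 * X ^ 3 - 12 * X ^ 4 - 94 * X ^ 5 - 138 * X ^ 6 -
        60 * X ^ 7 + 89 * X ^ 8 + 158 * X ^ 9 + 85 * X ^ 10 - 27 * X ^ 11 - 53 * X ^ 12 -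
        19 * X ^ 13 + 6 * X ^ 14 + 3 * X ^ 15) * h3 +
      (1 + 8 * X + 24 * X ^ 2 + 25 * X ^ 3 - 36 * X ^ 4 - 149 * X ^ 5 - 190 * X ^ 6 - 34 * X ^ 7 +
        238 * X ^ 8 + 364 * X ^ 9 + 220 * X ^ 10 - 22 * X ^ 11 - 126 * X ^ 12 - 73 * X ^ 13 -
        4 * X ^ 14 + 12 * X ^ 15 + 2 * X ^ 16) * h4 +
      (1 + 8 * X + 24 * X ^ 2 + 25 * X ^ 3 - 36 * X ^ 4 - 147 * X ^ 5 - 180 * X ^ 6 - 20 * X ^ 7 +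
        232 * X ^ 8 + 328 * X ^ 9 + 182 * X ^ 10 - 24 * X ^ 11 - 98 * X ^ 12 - 57 * X ^ 13 -
        8 * X ^ 14 + 4 * X ^ 15 + 2 * X ^ 16) * h5 +
      (1 + X) * (1 + 6 * X + 12 * X ^ 2 + 2 * X ^ 3 - 34 * X ^ 4 - 68 * X ^ 5 - 44 * X ^ 6 +
        46 * X ^ 7 + 117 * X ^ 8 + 92 * X ^ 9 + 3 * X ^ 10 - 48 * X ^ 11 - 29 * X ^ 12 +
        6 * X ^ 14) * h6 +
      (1 + X) * (1 + 6 * X + 12 * X ^ 2 + 2 * X ^ 3 - 34 * X ^ 4 - 68 * X ^ 5 - 44 * X ^ 6 +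
        46 * X ^ 7 + 117 * X ^ 8 + 92 * X ^ 9 + 3 * X ^ 10 - 48 * X ^ 11 - 29 * X ^ 12 +
        6 * X ^ 14) * h7 +
      (1 + X) * (1 + 7 * X + 17 * X ^ 2 + 10 * X ^ 3 - 33 * X ^ 4 - 83 * X ^ 5 - 70 * X ^ 6 +
        31 * X ^ 7 + 125 * X ^ 8 + 109 * X ^ 9 + 10 * X ^ 10 - 59 * X ^ 11 - 42 * X ^ 12 -
        3 * X ^ 13 + 10 * X ^ 14 + 2 * X ^ 15) * h8 +
      (1 + X) ^ 2 * (1 + 6 * X + 11 * X ^ 2 - 3 * X ^ 3 - 40 * X ^ 4 - 57 * X ^ 5 - 7 * X ^ 6 +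
        74 * X ^ 7 + 89 * X ^ 8 + 22 * X ^ 9 - 40 * X ^ 10 - 35 * X ^ 11 - 3 * X ^ 12 + 8 * X ^ 13
        + 2 * X ^ 14) * h9 +
      (1 + 7 * X + 18 * X ^ 2 + 15 * X ^ 3 - 26 * X ^ 4 - 89 * X ^ 5 - 104 * X ^ 6 - 17 * X ^ 7 +
        114 * X ^ 8 + 167 * X ^ 9 + 101 * X ^ 10 - 2 * X ^ 11 - 45 * X ^ 12 - 29 * X ^ 13 -
        5 * X ^ 14 + X ^ 15 + X ^ 16) * h10 +
      (1 + 9 * X + 32 * X ^ 2 + 51 * X ^ 3 + 6 * X ^ 4 - 125 * X ^ 5 - 230 * X ^ 6 - 145 * X ^ 7 +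
        106 * X ^ 8 + 273 * X ^ 9 + 195 * X ^ 10 - 93 * X ^ 12 - 53 * X ^ 13 - X ^ 14 + 9 * X ^ 15
        + X ^ 16) * h11 +
      (1 + X) * (1 + 7 * X + 17 * X ^ 2 + 9 * X ^ 3 - 39 * X ^ 4 - 96 * X ^ 5 - 80 * X ^ 6 +
        39 * X ^ 7 + 154 * X ^ 8 + 146 * X ^ 9 + 37 * X ^ 10 - 49 * X ^ 11 - 45 * X ^ 12 -
        11 * X ^ 13 + 5 * X ^ 14 + X ^ 15) * h12 +
      (1 + X) * (1 + 7 * X + 17 * X ^ 2 + 9 * X ^ 3 - 39 * X ^ 4 - 96 * X ^ 5 - 80 * X ^ 6 +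
        39 * X ^ 7 + 154 * X ^ 8 + 146 * X ^ 9 + 37 * X ^ 10 - 49 * X ^ 11 - 45 * X ^ 12 -
        11 * X ^ 13 + 5 * X ^ 14 + X ^ 15) * h13 +
      (1 + 7 * X + 18 * X ^ 2 + 15 * X ^ 3 - 26 * X ^ 4 - 88 * X ^ 5 - 99 * X ^ 6 - 9 * X ^ 7 +
        116 * X ^ 8 + 157 * X ^ 9 + 82 * X ^ 10 - 20 * X ^ 11 - 54 * X ^ 12 - 30 * X ^ 13 - X ^ 14
        + 5 * X ^ 15 + 2 * X ^ 16) * h14 +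
      (1 + 7 * X + 18 * X ^ 2 + 15 * X ^ 3 - 26 * X ^ 4 - 88 * X ^ 5 - 99 * X ^ 6 - 9 * X ^ 7 +
        116 * X ^ 8 + 157 * X ^ 9 + 82 * X ^ 10 - 20 * X ^ 11 - 54 * X ^ 12 - 30 * X ^ 13 - X ^ 14
        + 5 * X ^ 15 + 2 * X ^ 16) * h15

theorem constantCoeff_mckayDenominator : constantCoeff mckayDenominator = 1 := by
  simp [mckayDenominator]

/-- The parity of the distance to the root, the same for both trees of McKay. -/
def mckayParity (w : Fin 16) : Bool :=
  w ∈ ({1, 2, 6, 7, 8, 9, 12, 13} : Finset (Fin 16))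

theorem cliqueFree_three_mckayT₁ : mckayT₁.CliqueFree 3 := by
  have h : ∀ a b, mckayT₁.Adj a b → mckayParity a ≠ mckayParity b := by
    simp only [mckayT₁, SimpleGraph.fromEdgeSet_adj, Set.mem_insert_iff, Set.mem_singleton_iff]
    decide
  exact (SimpleGraph.Coloring.mk mckayParity (h _ _)).colorable.cliqueFree (by simp)

theorem cliqueFree_three_mckayT₂ : mckayT₂.CliqueFree 3 := by
  have h : ∀ a b, mckayT₂.Adj a b → mckayParity a ≠ mckayParity b := by
    simp only [mckayT₂, SimpleGraph.fromEdgeSet_adj, Set.mem_insert_iff, Set.mem_singleton_iff]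
    decide
  exact (SimpleGraph.Coloring.mk mckayParity (h _ _)).colorable.cliqueFree (by simp)

end McKay

theorem lemma3p2 {V : Type*} [Finite V] (τ : SimpleGraph V) (hτ : τ.IsTree) (root : V) :
    geodesicGrowthSeries (coalescence τ root mckayT₁ 0) =
      geodesicGrowthSeries (coalescence τ root mckayT₂ 0) := by
  have := Fintype.ofFinite V
  exact geodesicGrowthSeries_coalescence_eq τ root 0 (hτ.isAcyclic.cliqueFree le_rfl)
    cliqueFree_three_mckayT₁ cliqueFree_three_mckayT₂ constantCoeff_mckayDenominator
    rootElimination_mckayT₁ rootElimination_mckayT₂
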